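/- A lattice vector field is a real-valued function $w$ on the oriented edges of the graph $\mathbb Z^2$ (nearest neighbours) whose sum over the two orientations of every edge vanishes; its divergence at a vertex is the sum of its values over the four outgoing edges. Let $Q=(-\tfrac12,\tfrac12)^2$. The smoothed field $\mathbf 1_Q*w:\mathbb R^2\to\mathbb R^2$ is the convolution of $\mathbf 1_Q$ with $w$, where $w$ is regarded as the vector measure which, on each edge, is the value of $w$ times the unit vector of that edge times length measure; explicitly, at $p\in\mathbb R^2$, $$(\mathbf 1_Q*w)(p)=\sum_{z\in\mathbb Z^2}\ \sum_{k=1,2} w(z,z+e_k)\Big(\int_0^1 \mathbf 1_Q(p-z-te_k)\,dt\Big)e_k .$$ A mollifier is a function $\rho\in C_c^\infty(\mathbb R^2)$ with $\int\rho=1$. Random vector fields on $\mathbb R^2$ are jointly measurable in the sample point and the space variable, and their laws are taken on the product $\sigma$-algebra (finite-dimensional distributions). 1. Let $w$ be a lattice vector field whose divergence is $1$ at every vertex. Then $\mathbf 1_Q*w$ is differentiable with divergence $1$ at almost every point of $\mathbb R^2$, it is locally integrable, and its divergence in the sense of distributions is $1$. For every mollifier $\rho$ the field $\rho*(\mathbf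 1_Q*w)$ is $C^\infty$ with divergence $1$ everywhere. 2. There exist a probability space carrying a random lattice vector field $v$, stationary under all shifts of $\mathbb Z^2$, with divergence $1$ at every vertex almost surely, and a random vector $U$ independent of $v$ and uniformly distributed on $[0,1)^2$, such that, with $F(p)=(\mathbf 1_Q*v)(p+U)$ for $p\in\mathbb R^2$: - the law of $\mathbf 1_Q*v$ is invariant under all shifts by vectors of $\mathbb Z^2$, and $F$ is a stationary random vector field on $\mathbb R^2$, that is, its law is invariant under all shifts by vectors of $\mathbb R^2$; - almost surely, $F$ is differentiable with divergence $1$ at almost every point of $\mathbb R^2$, it is locally integrable, and its divergence in the sense of distributions is $1$; - for every mollifier $\rho$, the law of $\rho*(\mathbf 1_Q*v)$ is invariant under all shifts by vectors of $\mathbb Z^2$, $\rho*F$ is a stationary random vector field on $\mathbb R^2$ (invariant under all shifts by vectors of $\mathbb R^2$), and almost surely $\rho*F$ is $C^\infty$ with divergence $1$ at every point of $\mathbb R^2$. -/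

import Mathlib

open MeasureTheory ProbabilityTheory Set
open scoped ContDiff Convolution

noncomputable section

/-! ### Vector fields on the graph `ℤ²` -/

/-- The square lattice as a graph: two vertices are joined when they are at `ℓ¹`-distance `1`. -/
def latticeGraph : SimpleGraph (ℤ × ℤ) where
  Adj x y := |y.1 - x.1| + |y.2 - x.2| = 1
  symm := ⟨fun x y h => by rw [abs_sub_comm x.1, abs_sub_comm x.2]; exact h⟩
  loopless := ⟨fun x h => by simp at h⟩

/-- A vector field on `ℤ²`: a real function on oriented edges whose sum over the two
orientations of each edge vanishes. -/
abbrev LatticeField : Type :=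
  {w : latticeGraph.Dart → ℝ // ∀ d, w d + w d.symm = 0}

/-- The oriented edge from `x` to `x + e`, where `e` is one of the four unit vectors. -/
def edgeFrom (x e : ℤ × ℤ) (he : |e.1| + |e.2| = 1) : latticeGraph.Dart :=
  ⟨(x, x + e), by simpa [latticeGraph] using he⟩

/-- The oriented edge translated by `z`. -/
def shiftEdge (z : ℤ × ℤ) (d : latticeGraph.Dart) : latticeGraph.Dart :=
  ⟨(d.fst + z, d.snd + z), by simpa [latticeGraph] using d.adj⟩

namespace LatticeField

/-- The divergence at a vertex: the sum of the field over the four outgoing edges. -/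
def div (w : LatticeField) (x : ℤ × ℤ) : ℝ :=
  w.1 (edgeFrom x (1, 0) (by norm_num)) + w.1 (edgeFrom x (0, 1) (by norm_num)) +
    w.1 (edgeFrom x (-1, 0) (by norm_num)) + w.1 (edgeFrom x (0, -1) (by norm_num))

/-- The translated field `d ↦ w (d + z)`. -/
def shift (z : ℤ × ℤ) (w : LatticeField) : LatticeField :=
  ⟨fun d => w.1 (shiftEdge z d), fun d => w.2 (shiftEdge z d)⟩

/-- The indicator function of the open unit square centred at the origin. -/
def unitSquare : ℝ × ℝ → ℝ :=
  (Ioo (-1 / 2 : ℝ) (1 / 2) ×ˢ Ioo (-1 / 2 : ℝ) (1 / 2)).indicator 1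

/-- Convolution of a lattice field with the indicator of the unit square. The lattice field is
the vector-valued measure on `ℝ²` carried by the edges: the edge from `(i, j)` to `(i + 1, j)`
carries the horizontal vector `w` times length measure, and similarly for vertical edges.
At each point only finitely many terms of the sums are nonzero. -/
def smoothed (w : LatticeField) (p : ℝ × ℝ) : ℝ × ℝ :=
  (∑' z : ℤ × ℤ, w.1 (edgeFrom z (1, 0) (by norm_num)) *
      ∫ t in (0 : ℝ)..1, unitSquare (p - ((z.1 : ℝ) + t, (z.2 : ℝ))),
    ∑' z : ℤ × ℤ, w.1 (edgeFrom z (0, 1) (by norm_num)) *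
      ∫ t in (0 : ℝ)..1, unitSquare (p - ((z.1 : ℝ), (z.2 : ℝ) + t)))

end LatticeField

/-- A stationary random vector field on `ℤ²`. -/
def IsStationaryLattice {Ω : Type*} [MeasurableSpace Ω] (P : Measure Ω)
    (v : Ω → LatticeField) : Prop :=
  Measurable v ∧ ∀ z : ℤ × ℤ, P.map (fun s => (v s).shift z) = P.map v

/-! ### Vector fields on the plane -/

/-- A jointly measurable random vector field on `ℝ²` whose law (on the product σ-algebra, that
is, the family of finite-dimensional distributions) is invariant under the shifts in `S`. -/
def IsStationaryUnder {Ω : Type*} [MeasurableSpace Ω] (P : Measure Ω) (S : Set (ℝ × ℝ))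
    (F : Ω → ℝ × ℝ → ℝ × ℝ) : Prop :=
  Measurable (fun q : Ω × (ℝ × ℝ) => F q.1 q.2) ∧
    ∀ a ∈ S, P.map (fun s x => F s (x + a)) = P.map F

/-- The subset `ℤ²` of `ℝ²`. -/
def integerPoints : Set (ℝ × ℝ) := range fun z : ℤ × ℤ => ((z.1 : ℝ), (z.2 : ℝ))

/-- `F` is differentiable at `x` and its divergence there is `c`. -/
def HasDivergenceAt (F : ℝ × ℝ → ℝ × ℝ) (c : ℝ) (x : ℝ × ℝ) : Prop :=
  DifferentiableAt ℝ F x ∧ (fderiv ℝ F x (1, 0)).1 + (fderiv ℝ F x (0, 1)).2 = c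

/-- `F` is locally integrable and its divergence in the sense of distributions is the
constant `c`. -/
def HasDistribDivergence (F : ℝ × ℝ → ℝ × ℝ) (c : ℝ) : Prop :=
  LocallyIntegrable F ∧ ∀ φ : ℝ × ℝ → ℝ, ContDiff ℝ ∞ φ → HasCompactSupport φ →
    -∫ x, ((F x).1 * fderiv ℝ φ x (1, 0) + (F x).2 * fderiv ℝ φ x (0, 1)) = ∫ x, c * φ x

/-- A smooth compactly supported function on the plane with integral `1`. -/
def IsMollifier (ρ : ℝ × ℝ → ℝ) : Prop :=
  ContDiff ℝ ∞ ρ ∧ HasCompactSupport ρ ∧ ∫ x, ρ x = 1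

/-- The convolution `ρ * F`, i.e. `x ↦ ∫ ρ t • F (x - t) dt`. -/
def mollify (ρ : ℝ × ℝ → ℝ) (F : ℝ × ℝ → ℝ × ℝ) : ℝ × ℝ → ℝ × ℝ :=
  ρ ⋆[ContinuousLinearMap.lsmul ℝ ℝ, volume] F

end

/-!
Part one is deterministic. A component of the smoothed field is a locally finite sum of the kernels
`edgeKernel e (p - z)`, the convolution of the indicator of the unit square with length measure on
the edge from `z` to `z + e`. Integrating such a kernel against `∂φ/∂e` gives, by Fubini's theorem
and the fundamental theorem of calculus, the difference of the integrals of `φ` over the unit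
squares around the two endpoints of the edge (`integral_edgeKernel_mul_fderiv`). Summation by parts
over the lattice turns this into the sum over `z` of the lattice divergence at `z` times the integral
of `φ` over the square around `z`; these squares tile the plane, so a lattice field of constant
divergence has a smoothed field of the same distributional divergence
(`hasDistribDivergence_smoothed`). On each open square the smoothed field is affine, which gives the
pointwise divergence almost everywhere (`hasDivergenceAt_smoothed`). The divergence of `ρ * F` at `p`
is the pairing of `F` with the gradient of `y ↦ ρ (p - y)` (`HasDistribDivergence.mollify`).

A stationary field of divergence one cannot be integrable. It is built here on the dyadic odometer:
the vertices of `ℤ²` receive dyadic coordinates `(a, b)`, with a Haar distributed origin, and at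
scale `n` mass `4 ^ n` is moved from the vertices both of whose coordinates are multiples of
`2 ^ n` to those both of whose coordinates are multiples of `2 ^ (n + 1)`, first horizontally and
then vertically. The divergences of these transports telescope to one, because almost surely no
coordinate of a vertex is zero, so that each is a multiple of `2 ^ n` for finitely many `n` only;
for the same reason only finitely many scales use a given edge (`odometer_divergence`).

Stationarity of `F` under a translation by `a` comes from a skew product on the sample space: the
point `a + U` is split into its fractional part, which is again uniform, and its integer part, which
acts on the lattice field by a shift that preserves its law (`measurePreserving_planeShift`). All
laws are compared through measure-preserving maps of the sample space
(`isStationaryUnder_of_measurePreserving`).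
-/

noncomputable section

/-! ### Rotations of the unit square -/

/-- Both `[0, 1)` and `[a, a + 1)` are, up to null sets, fundamental domains for the translations by
integers, and `Int.fract` is invariant under these. -/
theorem measurePreserving_fract_const_add (a : ℝ) :
    MeasurePreserving (fun u : ℝ => Int.fract (a + u))
      (volume.restrict (Ico (0 : ℝ) 1)) (volume.restrict (Ico (0 : ℝ) 1)) := by
  have hm : Measurable fun u : ℝ => Int.fract u := measurable_fract
  have hm' : Measurable fun u : ℝ => Int.fract (a + u) := hm.comp (measurable_const_add a)
  refine ⟨hm', Measure.ext fun s hs => ?_⟩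
  rw [Measure.map_apply hm' hs, Measure.restrict_apply (hm' hs), Measure.restrict_apply hs]
  have h0 := isAddFundamentalDomain_Ioc (T := (1 : ℝ)) one_pos 0 volume
  have h1 := isAddFundamentalDomain_Ioc (T := (1 : ℝ)) one_pos a volume
  have hinv : ∀ g : AddSubgroup.zmultiples (1 : ℝ),
      (fun x => g +ᵥ x) ⁻¹' (Int.fract ⁻¹' s : Set ℝ) = Int.fract ⁻¹' s := by
    rintro ⟨_, n, rfl⟩
    ext x
    simp [AddSubgroup.vadd_def]
  have key := h1.measure_set_eq h0 (hm hs) hinv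
  rw [zero_add] at key
  calc volume ((fun u : ℝ => Int.fract (a + u)) ⁻¹' s ∩ Ico 0 1)
      = volume ((fun u : ℝ => a + u) ⁻¹' (Int.fract ⁻¹' s ∩ Ico a (a + 1))) := by
        congr 1; ext u; simp
    _ = volume (Int.fract ⁻¹' s ∩ Ico a (a + 1)) := measure_preimage_add _ _ _
    _ = volume (Int.fract ⁻¹' s ∩ Ioc a (a + 1)) :=
        measure_congr ((ae_eq_refl _).inter Ico_ae_eq_Ioc)
    _ = volume (Int.fract ⁻¹' s ∩ Ioc 0 1) := key
    _ = volume (Int.fract ⁻¹' s ∩ Ico 0 1) :=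
        measure_congr ((ae_eq_refl _).inter Ico_ae_eq_Ioc.symm)
    _ = volume (s ∩ Ico 0 1) := by
        congr 1; ext u
        constructor
        · rintro ⟨h, hu⟩
          have := Int.fract_eq_self.2 hu
          simp only [mem_preimage, this] at h
          exact ⟨h, hu⟩
        · rintro ⟨h, hu⟩
          have := Int.fract_eq_self.2 hu
          refine ⟨?_, hu⟩
          simpa only [mem_preimage, this] using h

/-! ### The value of a lattice field on edges -/

/-- The inclusion of `ℤ²` in `ℝ²`. -/
def latticePoint (z : ℤ × ℤ) : ℝ × ℝ := (z.1, z.2)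

@[simp] theorem latticePoint_add (x y : ℤ × ℤ) :
    latticePoint (x + y) = latticePoint x + latticePoint y := by
  simp [latticePoint]

namespace LatticeField

/-- The value of a field on the edge from `z` to `z + (1, 0)`. -/
def horiz (w : LatticeField) (z : ℤ × ℤ) : ℝ := w.1 (edgeFrom z (1, 0) (by norm_num))

/-- The value of a field on the edge from `z` to `z + (0, 1)`. -/
def vert (w : LatticeField) (z : ℤ × ℤ) : ℝ := w.1 (edgeFrom z (0, 1) (by norm_num))

theorem apply_edgeFrom_neg (w : LatticeField) (x e : ℤ × ℤ) (he : |e.1| + |e.2| = 1)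
    (he' : |(-e).1| + |(-e).2| = 1) :
    w.1 (edgeFrom x (-e) he') = -w.1 (edgeFrom (x - e) e he) := by
  have h := w.2 (edgeFrom x (-e) he')
  have : (edgeFrom x (-e) he').symm = edgeFrom (x - e) e he := by
    apply SimpleGraph.Dart.ext
    simp [edgeFrom, sub_eq_add_neg]
  rw [this] at h
  linarith

theorem div_eq (w : LatticeField) (x : ℤ × ℤ) :
    w.div x = w.horiz x - w.horiz (x - (1, 0)) + (w.vert x - w.vert (x - (0, 1))) := by
  have h1 := w.apply_edgeFrom_neg x (1, 0) (by norm_num) (by norm_num)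
  have h2 := w.apply_edgeFrom_neg x (0, 1) (by norm_num) (by norm_num)
  simp only [Prod.neg_mk, neg_zero] at h1 h2
  rw [div, h1, h2, horiz, horiz, vert, vert]
  ring

theorem horiz_shift (w : LatticeField) (k z : ℤ × ℤ) :
    (w.shift k).horiz z = w.horiz (z + k) := by
  simp only [horiz, shift]
  refine congrArg w.1 (SimpleGraph.Dart.ext _ _ ?_)
  simp [edgeFrom, shiftEdge, add_right_comm]

theorem vert_shift (w : LatticeField) (k z : ℤ × ℤ) :
    (w.shift k).vert z = w.vert (z + k) := by
  simp only [vert, shift]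
  refine congrArg w.1 (SimpleGraph.Dart.ext _ _ ?_)
  simp [edgeFrom, shiftEdge, add_right_comm]

@[fun_prop] theorem measurable_horiz (z : ℤ × ℤ) : Measurable fun w : LatticeField => w.horiz z :=
  (measurable_pi_apply _).comp measurable_subtype_coe

@[fun_prop] theorem measurable_vert (z : ℤ × ℤ) : Measurable fun w : LatticeField => w.vert z :=
  (measurable_pi_apply _).comp measurable_subtype_coe

/-- The lattice field with prescribed values `h` on the edges pointing right and `g` on the edges
pointing up; at most one of the two terms is nonzero on any given edge. -/
def ofEdges (h g : ℤ × ℤ → ℝ) : LatticeField :=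
  ⟨fun d => ((d.snd.1 - d.fst.1 : ℤ) : ℝ) * h (d.fst ⊓ d.snd) +
      ((d.snd.2 - d.fst.2 : ℤ) : ℝ) * g (d.fst ⊓ d.snd), fun d => by
    simp only [SimpleGraph.Dart.symm, Prod.fst_swap, Prod.snd_swap,
      inf_comm d.snd d.fst]
    push_cast
    ring⟩

@[simp] theorem horiz_ofEdges (h g : ℤ × ℤ → ℝ) (z : ℤ × ℤ) : (ofEdges h g).horiz z = h z := by
  have : z ⊓ (z + (1, 0)) = z := inf_eq_left.2 (by simp [Prod.le_def])
  simp [horiz, ofEdges, edgeFrom, this]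

@[simp] theorem vert_ofEdges (h g : ℤ × ℤ → ℝ) (z : ℤ × ℤ) : (ofEdges h g).vert z = g z := by
  have : z ⊓ (z + (0, 1)) = z := inf_eq_left.2 (by simp [Prod.le_def])
  simp [vert, ofEdges, edgeFrom, this]

theorem shift_ofEdges (h g : ℤ × ℤ → ℝ) (k : ℤ × ℤ) :
    (ofEdges h g).shift k = ofEdges (fun z => h (z + k)) fun z => g (z + k) := by
  apply Subtype.ext
  funext d
  have : (d.fst + k) ⊓ (d.snd + k) = d.fst ⊓ d.snd + k := by
    ext <;> simp [min_add_add_right]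
  simp [shift, ofEdges, shiftEdge, this]

theorem measurable_ofEdges {Ω : Type*} [MeasurableSpace Ω] {h g : Ω → ℤ × ℤ → ℝ}
    (hh : ∀ z, Measurable fun s => h s z) (hg : ∀ z, Measurable fun s => g s z) :
    Measurable fun s => ofEdges (h s) (g s) := by
  refine Measurable.subtype_mk (measurable_pi_iff.2 fun d => ?_)
  exact ((hh _).const_mul _).add ((hg _).const_mul _)

end LatticeField

namespace LatticeField

/-! ### The contribution of a single edge -/

/-- The unit square is a ball of the supremum norm, which is the norm of `ℝ × ℝ`. -/
theorem unitSquare_apply (p : ℝ × ℝ) :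
    unitSquare p = (Metric.ball (0 : ℝ × ℝ) (1 / 2)).indicator 1 p := by
  have : Ioo (-1 / 2 : ℝ) (1 / 2) ×ˢ Ioo (-1 / 2 : ℝ) (1 / 2) =
      Metric.ball (0 : ℝ × ℝ) (1 / 2) := by
    rw [← Prod.mk_zero_zero, ← ball_prod_same, Real.ball_eq_Ioo]
    norm_num
  rw [unitSquare, this]

theorem unitSquare_eq_mul (p : ℝ × ℝ) :
    unitSquare p = (Ioo (-1 / 2 : ℝ) (1 / 2)).indicator 1 p.1 *
      (Ioo (-1 / 2 : ℝ) (1 / 2)).indicator 1 p.2 := by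
  simp only [unitSquare, indicator_apply, mem_prod, Pi.one_apply, ite_and]
  split_ifs <;> simp

@[fun_prop] theorem measurable_unitSquare : Measurable unitSquare :=
  measurable_const.indicator (measurableSet_Ioo.prod measurableSet_Ioo)

theorem unitSquare_nonneg (p : ℝ × ℝ) : 0 ≤ unitSquare p :=
  indicator_nonneg (fun _ _ => zero_le_one) _

theorem unitSquare_le_one (p : ℝ × ℝ) : unitSquare p ≤ 1 :=
  indicator_le' (fun _ _ => le_rfl) (fun _ _ => zero_le_one) _

theorem norm_unitSquare_le_one (p : ℝ × ℝ) : ‖unitSquare p‖ ≤ 1 := by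
  rw [Real.norm_of_nonneg (unitSquare_nonneg p)]
  exact unitSquare_le_one p

theorem unitSquare_eq_zero {p : ℝ × ℝ} (h : 1 / 2 ≤ ‖p‖) : unitSquare p = 0 := by
  rw [unitSquare_apply, indicator_of_notMem]
  simpa using h

/-- The convolution of the indicator of the unit square with length measure on the segment from
the origin to `e`. -/
def edgeKernel (e p : ℝ × ℝ) : ℝ := ∫ t in (0 : ℝ)..1, unitSquare (p - t • e)

theorem smoothed_eq (w : LatticeField) (p : ℝ × ℝ) :
    w.smoothed p = (∑' z, w.horiz z * edgeKernel (1, 0) (p - latticePoint z),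
      ∑' z, w.vert z * edgeKernel (0, 1) (p - latticePoint z)) := by
  have h1 : ∀ (z : ℤ × ℤ) (t : ℝ),
      p - ((z.1 : ℝ) + t, (z.2 : ℝ)) = p - latticePoint z - t • ((1, 0) : ℝ × ℝ) := by
    intro z t; ext <;> simp [latticePoint]; ring
  have h2 : ∀ (z : ℤ × ℤ) (t : ℝ),
      p - ((z.1 : ℝ), (z.2 : ℝ) + t) = p - latticePoint z - t • ((0, 1) : ℝ × ℝ) := by
    intro z t; ext <;> simp [latticePoint]; ring
  simp only [smoothed, h1, h2]
  rfl

@[fun_prop] theorem measurable_edgeKernel (e : ℝ × ℝ) : Measurable (edgeKernel e) := by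
  have h : Measurable fun q : (ℝ × ℝ) × ℝ => unitSquare (q.1 - q.2 • e) := by fun_prop
  have := h.stronglyMeasurable.integral_prod_right' (ν := volume.restrict (Ioc (0 : ℝ) 1))
  have he : edgeKernel e = fun p => ∫ t in Ioc (0 : ℝ) 1, unitSquare (p - t • e) :=
    funext fun p => intervalIntegral.integral_of_le zero_le_one
  rw [he]
  exact this.measurable

theorem integrable_unitSquare_sub (a : ℝ × ℝ) : Integrable fun p => unitSquare (p - a) := by
  have h : Integrable unitSquare := by
    have : unitSquare = (Metric.ball (0 : ℝ × ℝ) (1 / 2)).indicator fun _ => 1 :=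
      funext unitSquare_apply
    rw [this, integrable_indicator_iff Metric.isOpen_ball.measurableSet]
    exact integrableOn_const measure_ball_lt_top.ne
  exact h.comp_sub_right a

theorem norm_edgeKernel_le_one (e p : ℝ × ℝ) : ‖edgeKernel e p‖ ≤ 1 := by
  have := intervalIntegral.norm_integral_le_of_norm_le_const (a := (0 : ℝ)) (b := 1)
    (f := fun t => unitSquare (p - t • e)) (C := 1) fun t _ => norm_unitSquare_le_one _
  simpa [edgeKernel] using this

theorem edgeKernel_eq_zero {e p : ℝ × ℝ} (he : ‖e‖ ≤ 1) (hp : 3 / 2 ≤ ‖p‖) :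
    edgeKernel e p = 0 := by
  rw [edgeKernel, intervalIntegral.integral_of_le zero_le_one]
  refine setIntegral_eq_zero_of_forall_eq_zero fun t ht => unitSquare_eq_zero ?_
  have h1 : ‖t • e‖ ≤ 1 := by
    rw [norm_smul, Real.norm_of_nonneg ht.1.le]
    exact mul_le_one₀ ht.2 (norm_nonneg _) he
  have := norm_sub_norm_le p (t • e)
  linarith

/-- The integral of the indicator of `(-1/2, 1/2)` over an interval of length one ending at `x`
is the tent function centred at `1/2`. -/
theorem integral_indicator_Ioo_sub (x : ℝ) :
    ∫ t in (0 : ℝ)..1, (Ioo (-1 / 2 : ℝ) (1 / 2)).indicator (1 : ℝ → ℝ) (x - t) =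
      max 0 (1 - |x - 1 / 2|) := by
  rw [intervalIntegral.integral_comp_sub_left (fun t => (Ioo (-1 / 2 : ℝ) (1 / 2)).indicator
    (1 : ℝ → ℝ) t) x, intervalIntegral.integral_of_le (by linarith),
    integral_indicator_one measurableSet_Ioo]
  simp only [measureReal_def, Measure.restrict_apply measurableSet_Ioo]
  have hae : volume (Ioo (-1 / 2 : ℝ) (1 / 2) ∩ Ioc (x - 1) (x - 0)) =
      volume (Ioc (-1 / 2 : ℝ) (1 / 2) ∩ Ioc (x - 1) (x - 0)) :=
    measure_congr (Ioo_ae_eq_Ioc.inter (ae_eq_refl _))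
  rw [hae, Ioc_inter_Ioc, Real.volume_Ioc, ENNReal.toReal_ofReal', max_comm]
  congr 1
  rcases abs_cases (x - 1 / 2) with ⟨h, h'⟩ | ⟨h, h'⟩ <;> rw [h]
  · rw [min_eq_left (by linarith), max_eq_right (by linarith)]; ring
  · rw [min_eq_right (by linarith), max_eq_left (by linarith)]; ring

theorem edgeKernel_horiz (p : ℝ × ℝ) :
    edgeKernel (1, 0) p = max 0 (1 - |p.1 - 1 / 2|) *
      (Ioo (-1 / 2 : ℝ) (1 / 2)).indicator 1 p.2 := by
  rw [← integral_indicator_Ioo_sub, ← intervalIntegral.integral_mul_const]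
  simp [edgeKernel, unitSquare_eq_mul]

theorem edgeKernel_vert (p : ℝ × ℝ) :
    edgeKernel (0, 1) p = (Ioo (-1 / 2 : ℝ) (1 / 2)).indicator 1 p.1 *
      max 0 (1 - |p.2 - 1 / 2|) := by
  rw [← integral_indicator_Ioo_sub, ← intervalIntegral.integral_const_mul]
  simp [edgeKernel, unitSquare_eq_mul]

/-- Integrating the kernel of an edge against the derivative along the edge gives the difference
of the integrals over the unit squares around its two endpoints. -/
theorem integral_edgeKernel_mul_fderiv {φ : ℝ × ℝ → ℝ} (hφ : ContDiff ℝ 1 φ)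
    (hc : HasCompactSupport φ) (e a : ℝ × ℝ) :
    ∫ p, edgeKernel e (p - a) * fderiv ℝ φ p e =
      (∫ p, unitSquare (p - (a + e)) * φ p) - ∫ p, unitSquare (p - a) * φ p := by
  have hd : Continuous fun p => fderiv ℝ φ p e :=
    (hφ.continuous_fderiv one_ne_zero).clm_apply continuous_const
  have hdc : HasCompactSupport fun p => fderiv ℝ φ p e := hc.fderiv_apply ℝ e
  have hdi : Integrable fun p => fderiv ℝ φ p e := hd.integrable_of_hasCompactSupport hdc
  have h1 : ∫ p, edgeKernel e (p - a) * fderiv ℝ φ p e =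
      ∫ t in Ioc (0 : ℝ) 1, ∫ p, unitSquare (p - a - t • e) * fderiv ℝ φ p e := by
    rw [integral_integral_swap]
    · refine integral_congr_ae (.of_forall fun p => ?_)
      simp only [edgeKernel, intervalIntegral.integral_of_le zero_le_one, integral_mul_const]
    · have hb : Integrable (fun q : ℝ × (ℝ × ℝ) => fderiv ℝ φ q.2 e)
          ((volume.restrict (Ioc (0 : ℝ) 1)).prod volume) := hdi.comp_snd _
      refine hb.bdd_mul (c := 1) ?_ (.of_forall fun q => norm_unitSquare_le_one _)
      exact Measurable.aestronglyMeasurable (by fun_prop)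
  have h2 : ∀ t : ℝ, ∫ p, unitSquare (p - a - t • e) * fderiv ℝ φ p e =
      ∫ p, unitSquare (p - a) * fderiv ℝ φ (p + t • e) e := fun t => by
    rw [← integral_add_right_eq_self _ (t • e)]
    simp [add_sub_right_comm]
  have h3 : ∫ t in Ioc (0 : ℝ) 1, ∫ p, unitSquare (p - a) * fderiv ℝ φ (p + t • e) e =
      ∫ p, ∫ t in Ioc (0 : ℝ) 1, unitSquare (p - a) * fderiv ℝ φ (p + t • e) e := by
    obtain ⟨C, hC⟩ := hdc.exists_bound_of_continuous hd
    rw [integral_integral_swap]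
    have hb : Integrable (fun q : ℝ × (ℝ × ℝ) => unitSquare (q.2 - a))
        ((volume.restrict (Ioc (0 : ℝ) 1)).prod volume) :=
      (integrable_unitSquare_sub a).comp_snd _
    refine hb.mul_bdd (c := C) ?_ (.of_forall fun q => hC _)
    exact (hd.comp (by fun_prop : Continuous fun q : ℝ × (ℝ × ℝ) =>
      q.2 + q.1 • e)).aestronglyMeasurable
  have h4 : ∀ p, ∫ t in Ioc (0 : ℝ) 1, fderiv ℝ φ (p + t • e) e = φ (p + e) - φ p := fun p => by
    rw [← intervalIntegral.integral_of_le zero_le_one,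
      intervalIntegral.integral_eq_sub_of_hasDerivAt (f := fun t : ℝ => φ (p + t • e))]
    · simp
    · intro t _
      have hl : HasDerivAt (fun t : ℝ => p + t • e) e t := by
        simpa using ((hasDerivAt_id t).smul_const e).const_add p
      exact ((hφ.differentiable one_ne_zero _).hasFDerivAt).comp_hasDerivAt t hl
    · exact (hd.comp (by fun_prop : Continuous fun t : ℝ => p + t • e)).intervalIntegrable _ _
  have hi : Integrable φ := hφ.continuous.integrable_of_hasCompactSupport hc
  have hQ : ∀ b : ℝ × ℝ, AEStronglyMeasurable (fun p => unitSquare (p - b)) :=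
    fun b => Measurable.aestronglyMeasurable (by fun_prop)
  have h5 : ∫ p, unitSquare (p - (a + e)) * φ p = ∫ p, unitSquare (p - a) * φ (p + e) := by
    rw [← integral_add_right_eq_self _ e]
    simp
  simp_rw [h1, h2, h3, integral_const_mul, h4, h5, mul_sub]
  exact integral_sub ((hi.comp_add_right e).bdd_mul (hQ a) (.of_forall fun q =>
    norm_unitSquare_le_one _)) (hi.bdd_mul (hQ a) (.of_forall fun q => norm_unitSquare_le_one _))

end LatticeField

namespace LatticeField

/-! ### The smoothed field as a locally finite sum -/

theorem norm_latticePoint (z : ℤ × ℤ) : ‖latticePoint z‖ = max |(z.1 : ℝ)| |(z.2 : ℝ)| := rfl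

theorem finite_norm_latticePoint_lt (R : ℝ) : {z : ℤ × ℤ | ‖latticePoint z‖ < R}.Finite := by
  refine (Set.finite_Icc ((-⌈R⌉, -⌈R⌉) : ℤ × ℤ) (⌈R⌉, ⌈R⌉)).subset fun z hz => ?_
  rw [mem_ofPred_eq, norm_latticePoint, max_lt_iff, abs_lt, abs_lt] at hz
  have hR := Int.le_ceil R
  have h1 : (z.1 : ℝ) ≤ ⌈R⌉ := by linarith
  have h2 : (z.2 : ℝ) ≤ ⌈R⌉ := by linarith
  have h3 : ((-⌈R⌉ : ℤ) : ℝ) ≤ z.1 := by push_cast; linarith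
  have h4 : ((-⌈R⌉ : ℤ) : ℝ) ≤ z.2 := by push_cast; linarith
  exact ⟨⟨Int.cast_le.1 h3, Int.cast_le.1 h4⟩, ⟨Int.cast_le.1 h1, Int.cast_le.1 h2⟩⟩

/-- One component of a smoothed field: `c z` is the value on the edge from `z` to `z + e`. -/
def edgeSum (c : ℤ × ℤ → ℝ) (e p : ℝ × ℝ) : ℝ := ∑' z, c z * edgeKernel e (p - latticePoint z)

theorem smoothed_eq_edgeSum (w : LatticeField) :
    w.smoothed = fun p => (edgeSum w.horiz (1, 0) p, edgeSum w.vert (0, 1) p) :=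
  funext w.smoothed_eq

theorem norm_e₁ : ‖((1, 0) : ℝ × ℝ)‖ ≤ 1 := by simp [Prod.norm_def]

theorem norm_e₂ : ‖((0, 1) : ℝ × ℝ)‖ ≤ 1 := by simp [Prod.norm_def]

/-- On the ball of radius `R` only the edges starting in this finite set contribute. -/
def nearby (R : ℝ) : Finset (ℤ × ℤ) := (finite_norm_latticePoint_lt (R + 3 / 2)).toFinset

theorem three_halves_le_norm_sub {R : ℝ} {p : ℝ × ℝ} (hp : ‖p‖ ≤ R) {z : ℤ × ℤ}
    (hz : z ∉ nearby R) : 3 / 2 ≤ ‖p - latticePoint z‖ := by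
  simp only [nearby, Finite.mem_toFinset, mem_ofPred_eq, not_lt] at hz
  have := norm_sub_norm_le (latticePoint z) p
  rw [norm_sub_rev] at this
  linarith

theorem edgeSum_eq_sum (c : ℤ × ℤ → ℝ) {e : ℝ × ℝ} (he : ‖e‖ ≤ 1) {R : ℝ} {p : ℝ × ℝ}
    (hp : ‖p‖ ≤ R) :
    edgeSum c e p = ∑ z ∈ nearby R, c z * edgeKernel e (p - latticePoint z) :=
  tsum_eq_sum fun z hz => by
    rw [edgeKernel_eq_zero he (three_halves_le_norm_sub hp hz), mul_zero]

theorem summable_edgeSum (c : ℤ × ℤ → ℝ) {e : ℝ × ℝ} (he : ‖e‖ ≤ 1) (p : ℝ × ℝ) :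
    Summable fun z => c z * edgeKernel e (p - latticePoint z) :=
  summable_of_ne_finset_zero (s := nearby ‖p‖) fun z hz => by
    rw [edgeKernel_eq_zero he (three_halves_le_norm_sub le_rfl hz), mul_zero]

theorem edgeSum_add (c : ℤ × ℤ → ℝ) (e p : ℝ × ℝ) (k : ℤ × ℤ) :
    edgeSum c e (p + latticePoint k) = edgeSum (fun z => c (z + k)) e p := by
  rw [edgeSum, ← (Equiv.addRight k).tsum_eq]
  simp [edgeSum]

theorem smoothed_shift (w : LatticeField) (k : ℤ × ℤ) (p : ℝ × ℝ) :
    (w.shift k).smoothed p = w.smoothed (p + latticePoint k) := by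
  simp_rw [smoothed_eq_edgeSum, edgeSum_add, ← horiz_shift, ← vert_shift]

/-- A pointwise convergent countable sum of measurable real functions is measurable. -/
theorem measurable_tsum_of_summable {α ι : Type*} [MeasurableSpace α] [Countable ι]
    {f : ι → α → ℝ} (hf : ∀ i, Measurable (f i)) (hs : ∀ x, Summable fun i => f i x) :
    Measurable fun x => ∑' i, f i x := by
  refine measurable_of_tendsto_metrizable' Filter.atTop
    (f := fun (s : Finset ι) x => ∑ i ∈ s, f i x) (fun s => by fun_prop) ?_
  exact tendsto_pi_nhds.2 fun x => (hs x).hasSum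

theorem measurable_smoothed :
    Measurable fun q : LatticeField × (ℝ × ℝ) => q.1.smoothed q.2 := by
  simp_rw [smoothed_eq_edgeSum]
  refine Measurable.prodMk ?_ ?_
  · exact measurable_tsum_of_summable (fun z => by fun_prop)
      fun q => summable_edgeSum q.1.horiz norm_e₁ q.2
  · exact measurable_tsum_of_summable (fun z => by fun_prop)
      fun q => summable_edgeSum q.1.vert norm_e₂ q.2

theorem locallyIntegrable_edgeSum (c : ℤ × ℤ → ℝ) {e : ℝ × ℝ} (he : ‖e‖ ≤ 1) :
    LocallyIntegrable (edgeSum c e) := by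
  intro x
  refine ⟨Metric.closedBall 0 (‖x‖ + 1), ?_, ?_⟩
  · exact Filter.mem_of_superset
      (Metric.isOpen_ball.mem_nhds (by simp : x ∈ Metric.ball (0 : ℝ × ℝ) (‖x‖ + 1)))
      Metric.ball_subset_closedBall
  have : IntegrableOn (fun p => ∑ z ∈ nearby (‖x‖ + 1), c z * edgeKernel e (p - latticePoint z))
      (Metric.closedBall 0 (‖x‖ + 1)) := by
    refine integrable_finsetSum _ fun z _ => Integrable.const_mul ?_ _
    exact IntegrableOn.of_bound measure_closedBall_lt_top
      (Measurable.aestronglyMeasurable (by fun_prop)) 1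
      (.of_forall fun p => norm_edgeKernel_le_one _ _)
  refine this.congr_fun (fun p hp => ?_) measurableSet_closedBall
  exact (edgeSum_eq_sum c he (by simpa using hp)).symm

theorem locallyIntegrable_smoothed (w : LatticeField) : LocallyIntegrable w.smoothed := by
  rw [smoothed_eq_edgeSum]
  intro x
  obtain ⟨s, hs, h1⟩ := locallyIntegrable_edgeSum w.horiz norm_e₁ x
  obtain ⟨t, ht, h2⟩ := locallyIntegrable_edgeSum w.vert norm_e₂ x
  exact ⟨s ∩ t, Filter.inter_mem hs ht, (h1.mono_set inter_subset_left).prodMk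
    (h2.mono_set inter_subset_right)⟩

/-! ### The pointwise divergence -/

/-- The open unit squares centred at the points of `ℤ²` cover almost all of the plane. -/
theorem ae_exists_mem_cell :
    ∀ᵐ p : ℝ × ℝ, ∃ z : ℤ × ℤ, p - latticePoint z ∈ Metric.ball (0 : ℝ × ℝ) (1 / 2) := by
  have h : ∀ᵐ x : ℝ, ∀ n : ℤ, x ≠ n + 1 / 2 := ae_all_iff.2 fun n => Measure.ae_ne _ _
  have h' : ∀ x : ℝ, (∀ n : ℤ, x ≠ n + 1 / 2) → ∃ n : ℤ, |x - n| < 1 / 2 := fun x hx => by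
    refine ⟨⌊x + 1 / 2⌋, ?_⟩
    have h1 := Int.floor_le (x + 1 / 2)
    have h2 := Int.lt_floor_add_one (x + 1 / 2)
    rcases h1.lt_or_eq with h1 | h1
    · rw [abs_lt]; constructor <;> linarith
    · refine (hx (⌊x + 1 / 2⌋ - 1) ?_).elim
      push_cast; linarith
  have hp : ∀ᵐ p : ℝ × ℝ, (∀ n : ℤ, p.1 ≠ n + 1 / 2) ∧ ∀ n : ℤ, p.2 ≠ n + 1 / 2 :=
    (Measure.quasiMeasurePreserving_fst.ae h).and (Measure.quasiMeasurePreserving_snd.ae h)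
  filter_upwards [hp] with p hp
  obtain ⟨m, hm⟩ := h' _ hp.1
  obtain ⟨n, hn⟩ := h' _ hp.2
  refine ⟨(m, n), ?_⟩
  rw [mem_ball_zero_iff, Prod.norm_def, max_lt_iff]
  exact ⟨hm, hn⟩

theorem mem_ball_iff {q : ℝ × ℝ} : q ∈ Metric.ball (0 : ℝ × ℝ) (1 / 2) ↔
    q.1 ∈ Ioo (-1 / 2 : ℝ) (1 / 2) ∧ q.2 ∈ Ioo (-1 / 2 : ℝ) (1 / 2) := by
  rw [mem_ball_zero_iff, Prod.norm_def, max_lt_iff, Real.norm_eq_abs, Real.norm_eq_abs, abs_lt,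
    abs_lt, neg_div]
  rfl

theorem eq_zero_of_cast_add_mem {x : ℝ} (hx : x ∈ Ioo (-1 / 2 : ℝ) (1 / 2)) {n : ℤ}
    (h : x + n ∈ Ioo (-1 / 2 : ℝ) (1 / 2)) : n = 0 := by
  have h1 : (n : ℝ) < (1 : ℤ) := by push_cast; linarith [hx.1, h.2]
  have h2 : ((-1 : ℤ) : ℝ) < n := by push_cast; linarith [hx.2, h.1]
  have h3 := Int.cast_lt.1 h1
  have h4 := Int.cast_lt.1 h2
  omega

/-- Of the points `x + n`, only `x` and `x + 1` lie in the support of the tent function centred at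
`1 / 2`. -/
theorem tent_eq_zero {x : ℝ} (hx : x ∈ Ioo (-1 / 2 : ℝ) (1 / 2)) {n : ℤ} (h0 : n ≠ 0)
    (h1 : n ≠ 1) : max 0 (1 - |x + n - 1 / 2|) = 0 := by
  refine max_eq_left ?_
  rw [sub_nonpos, le_abs]
  rcases (by omega : n ≤ -1 ∨ 2 ≤ n) with h | h
  · right
    have : (n : ℝ) ≤ (-1 : ℤ) := Int.cast_le.2 h
    push_cast at this
    linarith [hx.2]
  · left
    have : ((2 : ℤ) : ℝ) ≤ n := Int.cast_le.2 h
    push_cast at this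
    linarith [hx.1]

/-- On the unit square around `z` the horizontal component interpolates linearly between the values
on the two horizontal edges at `z`. -/
theorem edgeSum_horiz_of_mem (c : ℤ × ℤ → ℝ) {p : ℝ × ℝ} {z : ℤ × ℤ}
    (h : p - latticePoint z ∈ Metric.ball (0 : ℝ × ℝ) (1 / 2)) :
    edgeSum c (1, 0) p = c z * (1 / 2 + (p.1 - z.1)) + c (z - (1, 0)) * (1 / 2 - (p.1 - z.1)) := by
  obtain ⟨hx, hy⟩ := mem_ball_iff.1 h
  simp only [latticePoint, Prod.fst_sub, Prod.snd_sub] at hx hy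
  have hne : z ≠ z - (1, 0) := fun h => by simp [Prod.ext_iff] at h; omega
  rw [edgeSum, tsum_eq_sum (s := {z, z - (1, 0)}), Finset.sum_pair hne]
  · have a1 : |p.1 - z.1 - 1 / 2| = 1 / 2 - (p.1 - z.1) := by
      rw [abs_of_nonpos (by linarith [hx.2])]; ring
    have a2 : |p.1 - (z.1 - 1) - 1 / 2| = 1 / 2 + (p.1 - z.1) := by
      rw [abs_of_nonneg (by linarith [hx.1])]; ring
    simp only [edgeKernel_horiz, latticePoint, Prod.fst_sub, Prod.snd_sub, Int.cast_sub,
      Int.cast_one, sub_zero, indicator_of_mem hy, a1, a2, Pi.one_apply, mul_one]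
    rw [max_eq_right (by linarith [hx.1]), max_eq_right (by linarith [hx.2])]
    ring
  · intro k hk
    simp only [Finset.mem_insert, Finset.mem_singleton, Prod.ext_iff, Prod.fst_sub, Prod.snd_sub,
      sub_zero] at hk
    rw [edgeKernel_horiz]
    have e1 : (p - latticePoint k).1 = p.1 - z.1 + (z.1 - k.1 : ℤ) := by
      simp [latticePoint]
    have e2 : (p - latticePoint k).2 = p.2 - z.2 + (z.2 - k.2 : ℤ) := by
      simp [latticePoint]
    rw [e1, e2]
    by_cases h2 : z.2 - k.2 = 0
    · rw [tent_eq_zero hx (by omega) (by omega), zero_mul, mul_zero]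
    · rw [indicator_of_notMem (fun h' => h2 (eq_zero_of_cast_add_mem hy h'))]
      simp

theorem edgeSum_vert_of_mem (c : ℤ × ℤ → ℝ) {p : ℝ × ℝ} {z : ℤ × ℤ}
    (h : p - latticePoint z ∈ Metric.ball (0 : ℝ × ℝ) (1 / 2)) :
    edgeSum c (0, 1) p = c z * (1 / 2 + (p.2 - z.2)) + c (z - (0, 1)) * (1 / 2 - (p.2 - z.2)) := by
  obtain ⟨hx, hy⟩ := mem_ball_iff.1 h
  simp only [latticePoint, Prod.fst_sub, Prod.snd_sub] at hx hy
  have hne : z ≠ z - (0, 1) := fun h => by simp [Prod.ext_iff] at h; omega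
  rw [edgeSum, tsum_eq_sum (s := {z, z - (0, 1)}), Finset.sum_pair hne]
  · have a1 : |p.2 - z.2 - 1 / 2| = 1 / 2 - (p.2 - z.2) := by
      rw [abs_of_nonpos (by linarith [hy.2])]; ring
    have a2 : |p.2 - (z.2 - 1) - 1 / 2| = 1 / 2 + (p.2 - z.2) := by
      rw [abs_of_nonneg (by linarith [hy.1])]; ring
    simp only [edgeKernel_vert, latticePoint, Prod.fst_sub, Prod.snd_sub, Int.cast_sub,
      Int.cast_one, sub_zero, indicator_of_mem hx, a1, a2, Pi.one_apply, one_mul]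
    rw [max_eq_right (by linarith [hy.1]), max_eq_right (by linarith [hy.2])]
    ring
  · intro k hk
    simp only [Finset.mem_insert, Finset.mem_singleton, Prod.ext_iff, Prod.fst_sub, Prod.snd_sub,
      sub_zero] at hk
    rw [edgeKernel_vert]
    have e1 : (p - latticePoint k).1 = p.1 - z.1 + (z.1 - k.1 : ℤ) := by
      simp [latticePoint]
    have e2 : (p - latticePoint k).2 = p.2 - z.2 + (z.2 - k.2 : ℤ) := by
      simp [latticePoint]
    rw [e1, e2]
    by_cases h2 : z.1 - k.1 = 0
    · rw [tent_eq_zero hy (by omega) (by omega), mul_zero, mul_zero]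
    · rw [indicator_of_notMem (fun h' => h2 (eq_zero_of_cast_add_mem hx h'))]
      simp

/-- On the open unit square around `z` the smoothed field is affine, and its divergence is the
divergence of the lattice field at `z`. -/
theorem hasDivergenceAt_smoothed (w : LatticeField) {p : ℝ × ℝ} {z : ℤ × ℤ}
    (h : p - latticePoint z ∈ Metric.ball (0 : ℝ × ℝ) (1 / 2)) :
    HasDivergenceAt w.smoothed (w.div z) p := by
  have hev : w.smoothed =ᶠ[nhds p] fun q =>
      (w.horiz z * (1 / 2 + (q.1 - z.1)) + w.horiz (z - (1, 0)) * (1 / 2 - (q.1 - z.1)),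
        w.vert z * (1 / 2 + (q.2 - z.2)) + w.vert (z - (0, 1)) * (1 / 2 - (q.2 - z.2))) := by
    have ho : IsOpen ((fun q => q - latticePoint z) ⁻¹' Metric.ball (0 : ℝ × ℝ) (1 / 2)) :=
      Metric.isOpen_ball.preimage (by fun_prop)
    filter_upwards [ho.mem_nhds h] with q hq
    simp only [smoothed_eq_edgeSum]
    rw [edgeSum_horiz_of_mem _ hq, edgeSum_vert_of_mem _ hq]
  have h1 : HasFDerivAt (fun q : ℝ × ℝ =>
      w.horiz z * (1 / 2 + (q.1 - z.1)) + w.horiz (z - (1, 0)) * (1 / 2 - (q.1 - z.1)))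
      (w.horiz z • ContinuousLinearMap.fst ℝ ℝ ℝ +
        w.horiz (z - (1, 0)) • -ContinuousLinearMap.fst ℝ ℝ ℝ) p :=
    (((hasFDerivAt_fst.sub_const _).const_add _).const_mul _).add
      (((hasFDerivAt_fst.sub_const _).const_sub _).const_mul _)
  have h2 : HasFDerivAt (fun q : ℝ × ℝ =>
      w.vert z * (1 / 2 + (q.2 - z.2)) + w.vert (z - (0, 1)) * (1 / 2 - (q.2 - z.2)))
      (w.vert z • ContinuousLinearMap.snd ℝ ℝ ℝ +
        w.vert (z - (0, 1)) • -ContinuousLinearMap.snd ℝ ℝ ℝ) p :=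
    (((hasFDerivAt_snd.sub_const _).const_add _).const_mul _).add
      (((hasFDerivAt_snd.sub_const _).const_sub _).const_mul _)
  have h3 := (h1.prodMk h2).congr_of_eventuallyEq hev
  refine ⟨h3.differentiableAt, ?_⟩
  rw [h3.fderiv, div_eq]
  simp
  ring

theorem ae_hasDivergenceAt_smoothed {w : LatticeField} {c : ℝ} (hw : ∀ x, w.div x = c) :
    ∀ᵐ p : ℝ × ℝ, HasDivergenceAt w.smoothed c p := by
  filter_upwards [ae_exists_mem_cell] with p ⟨z, hz⟩
  exact hw z ▸ w.hasDivergenceAt_smoothed hz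

end LatticeField

namespace LatticeField

/-! ### The distributional divergence -/

/-- The integral of `φ` over the unit square centred at the lattice point `z`. -/
def cellIntegral (φ : ℝ × ℝ → ℝ) (z : ℤ × ℤ) : ℝ := ∫ p, unitSquare (p - latticePoint z) * φ p

theorem exists_norm_le_of_hasCompactSupport {φ : ℝ × ℝ → ℝ} (hc : HasCompactSupport φ) :
    ∃ R, ∀ p ∈ tsupport φ, ‖p‖ ≤ R :=
  hc.isBounded.exists_norm_le

theorem cellIntegral_eq_zero {φ : ℝ × ℝ → ℝ} {R : ℝ} (hR : ∀ p ∈ tsupport φ, ‖p‖ ≤ R) {z : ℤ × ℤ}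
    (hz : z ∉ nearby R) : cellIntegral φ z = 0 := by
  refine integral_eq_zero_of_ae (.of_forall fun p => ?_)
  by_cases hp : p ∈ tsupport φ
  · have := three_halves_le_norm_sub (hR p hp) hz
    simp [unitSquare_eq_zero (by linarith : 1 / 2 ≤ ‖p - latticePoint z‖)]
  · simp [image_eq_zero_of_notMem_tsupport hp]

theorem summable_mul_cellIntegral (c : ℤ × ℤ → ℝ) {φ : ℝ × ℝ → ℝ} (hc : HasCompactSupport φ) :
    Summable fun z => c z * cellIntegral φ z := by
  obtain ⟨R, hR⟩ := exists_norm_le_of_hasCompactSupport hc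
  exact summable_of_ne_finset_zero (s := nearby R) fun z hz => by
    rw [cellIntegral_eq_zero hR hz, mul_zero]

theorem unitSquare_sub_eq_ite {p : ℝ × ℝ} {z : ℤ × ℤ}
    (h : p - latticePoint z ∈ Metric.ball (0 : ℝ × ℝ) (1 / 2)) (k : ℤ × ℤ) :
    unitSquare (p - latticePoint k) = if k = z then 1 else 0 := by
  rw [unitSquare_apply]
  split_ifs with hk
  · rw [hk, indicator_of_mem h]; rfl
  · refine indicator_of_notMem (fun h' => hk ?_) _
    rw [mem_ball_iff] at h h'
    have e1 : (p - latticePoint k).1 = (p - latticePoint z).1 + (z.1 - k.1 : ℤ) := by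
      simp [latticePoint]
    have e2 : (p - latticePoint k).2 = (p - latticePoint z).2 + (z.2 - k.2 : ℤ) := by
      simp [latticePoint]
    rw [e1, e2] at h'
    have h1 := eq_zero_of_cast_add_mem h.1 h'.1
    have h2 := eq_zero_of_cast_add_mem h.2 h'.2
    ext <;> omega

/-- The unit squares around the lattice points tile the plane up to a null set. -/
theorem tsum_cellIntegral {φ : ℝ × ℝ → ℝ} (hφ : Continuous φ) (hc : HasCompactSupport φ) :
    ∑' z, cellIntegral φ z = ∫ p, φ p := by
  obtain ⟨R, hR⟩ := exists_norm_le_of_hasCompactSupport hc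
  rw [tsum_eq_sum fun z hz => cellIntegral_eq_zero hR hz]
  simp only [cellIntegral]
  rw [← integral_finsetSum _ fun z _ => ?_]
  · refine integral_congr_ae ?_
    filter_upwards [ae_exists_mem_cell] with p ⟨z, hz⟩
    by_cases hp : p ∈ tsupport φ
    · have hzR : z ∈ nearby R := by
        by_contra hzR
        have := three_halves_le_norm_sub (hR p hp) hzR
        rw [mem_ball_zero_iff] at hz
        linarith
      simp [unitSquare_sub_eq_ite hz, hzR]
    · simp [image_eq_zero_of_notMem_tsupport hp]
  · exact (hφ.integrable_of_hasCompactSupport hc).bdd_mul (c := 1)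
      (Measurable.aestronglyMeasurable (by fun_prop)) (.of_forall fun p => norm_unitSquare_le_one _)

/-- Summation by parts for the component of the smoothed field in the direction `ε`. -/
theorem integral_edgeSum_mul_fderiv (c : ℤ × ℤ → ℝ) {ε : ℤ × ℤ} (hε : ‖latticePoint ε‖ ≤ 1)
    {φ : ℝ × ℝ → ℝ} (hφ : ContDiff ℝ 1 φ) (hc : HasCompactSupport φ) :
    ∫ p, edgeSum c (latticePoint ε) p * fderiv ℝ φ p (latticePoint ε) =
      ∑' z, (c (z - ε) - c z) * cellIntegral φ z := by
  obtain ⟨R, hR⟩ := exists_norm_le_of_hasCompactSupport hc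
  set e := latticePoint ε with he
  have hzero : ∀ p, p ∉ tsupport φ → fderiv ℝ φ p e = 0 := fun p hp => by
    rw [fderiv_of_notMem_tsupport ℝ hp]; rfl
  have hdi : Integrable fun p => fderiv ℝ φ p e :=
    ((hφ.continuous_fderiv one_ne_zero).clm_apply continuous_const).integrable_of_hasCompactSupport
      (hc.fderiv_apply ℝ e)
  have hK : ∀ z, ∫ p, edgeKernel e (p - latticePoint z) * fderiv ℝ φ p e =
      cellIntegral φ (z + ε) - cellIntegral φ z := fun z => by
    rw [integral_edgeKernel_mul_fderiv hφ hc, cellIntegral, cellIntegral, latticePoint_add]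
  have hK0 : ∀ z ∉ nearby R, cellIntegral φ (z + ε) - cellIntegral φ z = 0 := fun z hz => by
    rw [← hK]
    refine integral_eq_zero_of_ae (.of_forall fun p => ?_)
    by_cases hp : p ∈ tsupport φ
    · simp [edgeKernel_eq_zero hε (three_halves_le_norm_sub (hR p hp) hz)]
    · simp [hzero p hp]
  have hsum1 := summable_mul_cellIntegral (fun z => c (z - ε)) hc
  have hsum1' : Summable fun z => c z * cellIntegral φ (z + ε) := by
    simpa [Function.comp_def] using (Equiv.addRight ε).summable_iff.2 hsum1
  have hshift : ∑' z, c z * cellIntegral φ (z + ε) = ∑' z, c (z - ε) * cellIntegral φ z := by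
    simpa using (Equiv.addRight ε).tsum_eq fun z => c (z - ε) * cellIntegral φ z
  have hsum2 := summable_mul_cellIntegral c hc
  calc ∫ p, edgeSum c e p * fderiv ℝ φ p e
      = ∫ p, ∑ z ∈ nearby R, c z * (edgeKernel e (p - latticePoint z) * fderiv ℝ φ p e) := by
        refine integral_congr_ae (.of_forall fun p => ?_)
        by_cases hp : p ∈ tsupport φ
        · simp only [edgeSum_eq_sum c hε (hR p hp), Finset.sum_mul, mul_assoc]
        · simp [hzero p hp]
    _ = ∑ z ∈ nearby R, c z * (cellIntegral φ (z + ε) - cellIntegral φ z) := by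
        rw [integral_finsetSum]
        · simp only [integral_const_mul, hK]
        · exact fun z _ => (hdi.bdd_mul (c := 1) (Measurable.aestronglyMeasurable (by fun_prop))
            (.of_forall fun p => norm_edgeKernel_le_one _ _)).const_mul _
    _ = ∑' z, c z * (cellIntegral φ (z + ε) - cellIntegral φ z) :=
        (tsum_eq_sum fun z hz => by rw [hK0 z hz, mul_zero]).symm
    _ = ∑' z, (c (z - ε) - c z) * cellIntegral φ z := by
        simp_rw [mul_sub, sub_mul]
        rw [Summable.tsum_sub hsum1' hsum2, Summable.tsum_sub hsum1 hsum2, hshift]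

theorem hasDistribDivergence_smoothed {w : LatticeField} {c : ℝ} (hw : ∀ x, w.div x = c) :
    HasDistribDivergence w.smoothed c := by
  refine ⟨w.locallyIntegrable_smoothed, fun φ hφ hc => ?_⟩
  have hφ1 : ContDiff ℝ 1 φ := hφ.of_le (by norm_cast)
  have e1 : latticePoint (1, 0) = (1, 0) := by simp [latticePoint]
  have e2 : latticePoint (0, 1) = (0, 1) := by simp [latticePoint]
  have h1 := integral_edgeSum_mul_fderiv w.horiz (e1 ▸ norm_e₁) hφ1 hc
  have h2 := integral_edgeSum_mul_fderiv w.vert (e2 ▸ norm_e₂) hφ1 hc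
  rw [e1] at h1
  rw [e2] at h2
  have hi : ∀ (c : ℤ × ℤ → ℝ) {e : ℝ × ℝ} (_ : ‖e‖ ≤ 1),
      Integrable fun p => edgeSum c e p * fderiv ℝ φ p e := fun c e he =>
    (locallyIntegrable_edgeSum c he).integrable_smul_right_of_hasCompactSupport
      ((hφ1.continuous_fderiv one_ne_zero).clm_apply continuous_const) (hc.fderiv_apply ℝ e)
  simp only [smoothed_eq_edgeSum]
  rw [integral_add (hi _ norm_e₁) (hi _ norm_e₂), h1, h2, ← Summable.tsum_add, ← tsum_neg,
    integral_const_mul, ← tsum_cellIntegral hφ.continuous hc, ← tsum_mul_left]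
  · refine tsum_congr fun z => ?_
    rw [← hw z, div_eq]
    ring
  · exact summable_mul_cellIntegral (fun z => w.horiz (z - (1, 0)) - w.horiz z) hc
  · exact summable_mul_cellIntegral (fun z => w.vert (z - (0, 1)) - w.vert z) hc

end LatticeField

/-! ### Translation and mollification of fields with constant divergence -/

theorem HasDivergenceAt.comp_add_right {F : ℝ × ℝ → ℝ × ℝ} {c : ℝ} {x a : ℝ × ℝ}
    (h : HasDivergenceAt F c (x + a)) : HasDivergenceAt (fun p => F (p + a)) c x := by
  refine ⟨(differentiableAt_comp_add_right a).2 h.1, ?_⟩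
  rw [fderiv_comp_add_right]
  exact h.2

theorem HasDistribDivergence.comp_add_right {F : ℝ × ℝ → ℝ × ℝ} {c : ℝ}
    (h : HasDistribDivergence F c) (a : ℝ × ℝ) :
    HasDistribDivergence (fun p => F (p + a)) c := by
  refine ⟨fun x => ?_, fun φ hφ hc => ?_⟩
  · obtain ⟨s, hs, hi⟩ := h.1 (x + a)
    refine ⟨(fun p => p + a) ⁻¹' s, (continuous_add_const a).continuousAt.preimage_mem_nhds hs, ?_⟩
    exact ((measurePreserving_add_right volume a).integrableOn_comp_preimage
      (measurableEmbedding_addRight a)).2 hi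
  · have hcs : HasCompactSupport fun p => φ (p - a) :=
      hc.comp_homeomorph (Homeomorph.subRight a)
    have := h.2 (fun p => φ (p - a)) (hφ.comp (contDiff_id.sub contDiff_const)) hcs
    rw [← integral_add_right_eq_self _ a,
      ← integral_add_right_eq_self (fun p => c * φ (p - a)) a] at this
    simpa [fderiv_comp_sub] using this

/-- The divergence of `ρ * F` at `p` is the pairing of `F` with the gradient of the test function
`y ↦ ρ (p - y)`. -/
theorem HasDistribDivergence.mollify {F : ℝ × ℝ → ℝ × ℝ} {c : ℝ} (h : HasDistribDivergence F c)
    {ρ : ℝ × ℝ → ℝ} (hρ : IsMollifier ρ) :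
    ContDiff ℝ ∞ (mollify ρ F) ∧ ∀ p, HasDivergenceAt (_root_.mollify ρ F) c p := by
  obtain ⟨hs, hc, h1⟩ := hρ
  have hs1 : ContDiff ℝ 1 ρ := hs.of_le (by norm_cast)
  refine ⟨hc.contDiff_convolution_left _ hs h.1, fun p => ?_⟩
  have hd := hc.hasFDerivAt_convolution_left (ContinuousLinearMap.lsmul ℝ ℝ) hs1 h.1 p
  refine ⟨hd.differentiableAt, ?_⟩
  have hfd : fderiv ℝ (_root_.mollify ρ F) p = _ := hd.fderiv
  have hex := (hc.fderiv (𝕜 := ℝ)).convolutionExists_left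
    ((ContinuousLinearMap.lsmul ℝ ℝ).precompL (ℝ × ℝ) : _ →L[ℝ] (ℝ × ℝ) →L[ℝ] _)
    (hs1.continuous_fderiv one_ne_zero) h.1 p
  have happ : ∀ v : ℝ × ℝ, fderiv ℝ (_root_.mollify ρ F) p v =
      ∫ t, fderiv ℝ ρ t v • F (p - t) := fun v => by
    rw [hfd, convolution, ContinuousLinearMap.integral_apply hex]
    rfl
  have hint : ∀ v : ℝ × ℝ, Integrable fun t => fderiv ℝ ρ t v • F (p - t) := fun v =>
    hex.apply_continuousLinearMap v
  have hφ : ∀ y v, fderiv ℝ (fun y => ρ (p - y)) y v = -fderiv ℝ ρ (p - y) v := fun y v => by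
    have h1 := (hs1.differentiable one_ne_zero (p - y)).hasFDerivAt.comp y
      ((hasFDerivAt_id y).const_sub p)
    have h2 : fderiv ℝ (fun y => ρ (p - y)) y = _ := h1.fderiv
    simp [h2]
  have key := h.2 (fun y => ρ (p - y)) (hs.comp (contDiff_const.sub contDiff_id))
    (hc.comp_homeomorph (Homeomorph.subLeft p))
  rw [integral_const_mul, integral_sub_left_eq_self ρ volume p, h1, mul_one,
    ← integral_sub_left_eq_self _ volume p] at key
  rw [happ, happ, ← key, ← integral_neg]
  have hf : ∀ v, (∫ t, fderiv ℝ ρ t v • F (p - t)).1 = ∫ t, fderiv ℝ ρ t v * (F (p - t)).1 :=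
    fun v => ((ContinuousLinearMap.fst ℝ ℝ ℝ).integral_comp_comm (hint v)).symm
  have hg : ∀ v, (∫ t, fderiv ℝ ρ t v • F (p - t)).2 = ∫ t, fderiv ℝ ρ t v * (F (p - t)).2 :=
    fun v => ((ContinuousLinearMap.snd ℝ ℝ ℝ).integral_comp_comm (hint v)).symm
  have hif : Integrable fun t => fderiv ℝ ρ t (1, 0) * (F (p - t)).1 := (hint _).fst
  have hig : Integrable fun t => fderiv ℝ ρ t (0, 1) * (F (p - t)).2 := (hint _).snd
  rw [hf, hg, ← integral_add hif hig]
  refine integral_congr_ae (.of_forall fun t => ?_)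
  simp only [hφ, sub_sub_cancel]
  ring

/-! ### The dyadic odometer -/

/-- The dyadic integers carry their Borel `σ`-algebra. -/
instance dyadicMeasurableSpace : MeasurableSpace ℤ_[2] := borel _

instance dyadicBorelSpace : BorelSpace ℤ_[2] := ⟨rfl⟩

/-- The Haar probability measure on the dyadic integers. -/
def dyadicMeasure : Measure ℤ_[2] := Measure.addHaarMeasure ⊤

instance : dyadicMeasure.IsAddHaarMeasure :=
  inferInstanceAs (Measure.addHaarMeasure ⊤).IsAddHaarMeasure

instance : IsProbabilityMeasure dyadicMeasure :=
  ⟨by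
    rw [dyadicMeasure]
    simpa using Measure.addHaarMeasure_self
      (K₀ := (⊤ : TopologicalSpace.PositiveCompacts ℤ_[2]))⟩

instance : (nhdsWithin (0 : ℤ_[2]) {0}ᶜ).NeBot := by
  rw [← mem_closure_iff_nhdsWithin_neBot]
  refine mem_closure_of_tendsto (tendsto_pow_atTop_nhds_zero_of_norm_lt_one
    (x := (2 : ℤ_[2])) ?_) (.of_forall fun n => ?_)
  · have : ‖((2 : ℕ) : ℤ_[2])‖ < 1 := by rw [PadicInt.norm_p]; norm_num
    exact_mod_cast this
  · exact pow_ne_zero n (by norm_num)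

theorem ae_add_intCast_ne_zero : ∀ᵐ a : ℤ_[2] ∂dyadicMeasure, ∀ i : ℤ, a + i ≠ 0 := by
  refine ae_all_iff.2 fun i : ℤ => ?_
  filter_upwards [Measure.ae_ne dyadicMeasure (-(i : ℤ_[2]))] with a ha h
  exact ha (eq_neg_of_add_eq_zero_left h)

theorem measurable_toZModPow_val (n : ℕ) :
    Measurable fun a : ℤ_[2] => (PadicInt.toZModPow n a).val := by
  let _ : MeasurableSpace (ZMod (2 ^ n)) := ⊤
  -- the fibres of the reduction modulo `2 ^ n` are closed balls
  have h : Measurable fun a : ℤ_[2] => PadicInt.toZModPow n a := by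
    refine measurable_to_countable' fun c => ?_
    have : (fun a : ℤ_[2] => PadicInt.toZModPow n a) ⁻¹' {c} =
        Metric.closedBall (c.val : ℤ_[2]) ((2 : ℕ) ^ (-n : ℤ)) := by
      ext a
      rw [Metric.mem_closedBall, dist_eq_norm, PadicInt.norm_le_pow_iff_mem_span_pow,
        ← PadicInt.ker_toZModPow, RingHom.mem_ker, map_sub, map_natCast, ZMod.natCast_zmod_val,
        sub_eq_zero]
      rfl
    rw [this]
    exact measurableSet_closedBall
  exact measurable_from_top.comp h

/-- The indicator of the nonzero multiples of `2 ^ n`. Excluding zero, which is a multiple of every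
power, makes all sums over the scales finite. -/
def dyadicDvd (n : ℕ) (a : ℤ_[2]) : ℝ :=
  {a : ℤ_[2] | a ≠ 0 ∧ (PadicInt.toZModPow n a).val = 0}.indicator 1 a

/-- The residue modulo `2 ^ n`, normalised to take values in `[0, 1)`. -/
def sawtooth (n : ℕ) (a : ℤ_[2]) : ℝ := (PadicInt.toZModPow n a).val / 2 ^ n

@[fun_prop] theorem measurable_dyadicDvd (n : ℕ) : Measurable (dyadicDvd n) :=
  measurable_const.indicator ((measurableSet_singleton 0).compl.inter
    (measurable_toZModPow_val n (measurableSet_singleton 0)))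

@[fun_prop] theorem measurable_sawtooth (n : ℕ) : Measurable (sawtooth n) :=
  (measurable_from_top.comp (measurable_toZModPow_val n) :
    Measurable fun a : ℤ_[2] => ((PadicInt.toZModPow n a).val : ℝ)).div_const _

theorem dyadicDvd_eq_one {n : ℕ} {a : ℤ_[2]} (ha : a ≠ 0) (h : (PadicInt.toZModPow n a).val = 0) :
    dyadicDvd n a = 1 :=
  indicator_of_mem (s := {a : ℤ_[2] | a ≠ 0 ∧ (PadicInt.toZModPow n a).val = 0}) ⟨ha, h⟩ _

theorem dyadicDvd_eq_zero {n : ℕ} {a : ℤ_[2]} (h : (PadicInt.toZModPow n a).val ≠ 0) :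
    dyadicDvd n a = 0 :=
  indicator_of_notMem (fun h' => h h'.2) _

theorem dyadicDvd_zero_left {a : ℤ_[2]} (ha : a ≠ 0) : dyadicDvd 0 a = 1 := by
  have : Subsingleton (ZMod (2 ^ 0)) := inferInstanceAs (Subsingleton (ZMod 1))
  exact dyadicDvd_eq_one ha (by
    rw [Subsingleton.elim (PadicInt.toZModPow 0 a) 0, ZMod.val_zero])

theorem exists_dyadicDvd_eq_zero (a : ℤ_[2]) : ∃ N, ∀ n ≥ N, dyadicDvd n a = 0 := by
  by_cases ha : a = 0
  · exact ⟨0, fun n _ => indicator_of_notMem (fun h => h.1 ha) _⟩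
  · obtain ⟨N, hN⟩ : ∃ N, PadicInt.toZModPow N a ≠ PadicInt.toZModPow N 0 := by
      by_contra! h
      exact ha (PadicInt.ext_of_toZModPow.1 h)
    refine ⟨N, fun n hn => indicator_of_notMem (fun h => hN ?_) _⟩
    have h0 := (ZMod.val_eq_zero _).1 h.2
    rw [← PadicInt.cast_toZModPow N n hn, h0, map_zero, ZMod.cast_zero]

/-- A unit step raises the residue by one, except that it drops by `2 ^ n - 1` on reaching a
multiple of `2 ^ n`. -/
theorem sawtooth_sub_sawtooth (n : ℕ) {a : ℤ_[2]} (ha : a ≠ 0) :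
    sawtooth n a - sawtooth n (a - 1) = 1 / 2 ^ n - dyadicDvd n a := by
  have hN : (2 : ℝ) ^ n ≠ 0 := by positivity
  have h1D : (PadicInt.toZModPow n a).val = 0 → dyadicDvd n a = 1 := dyadicDvd_eq_one ha
  have h0D : (PadicInt.toZModPow n a).val ≠ 0 → dyadicDvd n a = 0 := dyadicDvd_eq_zero
  simp only [sawtooth, map_sub, map_one]
  generalize PadicInt.toZModPow n a = x at h1D h0D ⊢
  have hlt := ZMod.val_lt x
  by_cases hx : x.val = 0
  · obtain ⟨m, hm⟩ : ∃ m, 2 ^ n = m + 1 := Nat.exists_eq_succ_of_ne_zero (by positivity)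
    have h1 : ((0 - 1 : ZMod (2 ^ n)).val : ℝ) = 2 ^ n - 1 := by
      have : (0 - 1 : ZMod (2 ^ n)).val = m := by
        rw [hm, zero_sub]; exact ZMod.val_neg_one m
      have h2 : (2 : ℝ) ^ n = m + 1 := by exact_mod_cast hm
      rw [this, h2]; ring
    rw [h1D hx, hx, (ZMod.val_eq_zero x).1 hx, h1]
    field_simp
    push_cast
    ring
  -- away from zero, `x - 1` has residue `x.val - 1`
  · have h1 : x - 1 = ((x.val - 1 : ℕ) : ZMod (2 ^ n)) := by
      rw [Nat.cast_sub (Nat.one_le_iff_ne_zero.2 hx), ZMod.natCast_zmod_val, Nat.cast_one]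
    rw [h0D hx, h1, ZMod.val_natCast_of_lt (by omega),
      Nat.cast_sub (Nat.one_le_iff_ne_zero.2 hx), Nat.cast_one]
    ring

/-- The transport profile at scale `n`, which is minus the binary digit of `a` of weight
`2 ^ n`. As `a` increases by one it jumps by twice the indicator of the multiples of `2 ^ (n + 1)`
minus the indicator of the multiples of `2 ^ n`. -/
def scaleProfile (n : ℕ) (a : ℤ_[2]) : ℝ := sawtooth n a - 2 * sawtooth (n + 1) a

@[fun_prop] theorem measurable_scaleProfile (n : ℕ) : Measurable (scaleProfile n) :=
  (measurable_sawtooth n).sub ((measurable_sawtooth (n + 1)).const_mul 2)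

theorem scaleProfile_sub_scaleProfile (n : ℕ) {a : ℤ_[2]} (ha : a ≠ 0) :
    scaleProfile n a - scaleProfile n (a - 1) = 2 * dyadicDvd (n + 1) a - dyadicDvd n a := by
  have h1 := sawtooth_sub_sawtooth n ha
  have h2 := sawtooth_sub_sawtooth (n + 1) ha
  have h3 : 2 * (1 / 2 ^ (n + 1) : ℝ) = 1 / 2 ^ n := by
    rw [pow_succ]; field_simp
  simp only [scaleProfile]
  linear_combination h1 - 2 * h2 - h3

/-! ### A random lattice field with divergence one -/

/-- The value on the horizontal edge leaving the vertex with dyadic coordinates `q`: at scale `n`,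
mass `4 ^ n` moves right from each odd multiple of `2 ^ n` to the next multiple of `2 ^ (n + 1)`,
along the rows whose vertical coordinate is a multiple of `2 ^ n`. -/
def odometerHoriz (q : ℤ_[2] × ℤ_[2]) : ℝ :=
  ∑' n : ℕ, -(4 ^ n * dyadicDvd n q.2 * scaleProfile n q.1)

/-- The value on the vertical edge leaving the vertex with dyadic coordinates `q`: at scale `n`,
mass `2 * 4 ^ n` moves up from each odd multiple of `2 ^ n` to the next multiple of `2 ^ (n + 1)`,
along the columns whose horizontal coordinate is a multiple of `2 ^ (n + 1)`. -/
def odometerVert (q : ℤ_[2] × ℤ_[2]) : ℝ :=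
  ∑' n : ℕ, -(2 * 4 ^ n * dyadicDvd (n + 1) q.1 * scaleProfile n q.2)

/-- Only the scales `n` at which `2 ^ n` divides the vertical coordinate use a horizontal edge. -/
theorem hasSum_odometerHoriz {b : ℤ_[2]} {N : ℕ} (hN : ∀ n ≥ N, dyadicDvd n b = 0) (a : ℤ_[2]) :
    HasSum (fun n : ℕ => -(4 ^ n * dyadicDvd n b * scaleProfile n a))
      (∑ n ∈ Finset.range N, -(4 ^ n * dyadicDvd n b * scaleProfile n a)) :=
  hasSum_sum_of_ne_finset_zero fun n hn => by
    rw [hN n (by simpa using hn)]; ring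

theorem hasSum_odometerVert {a : ℤ_[2]} {N : ℕ} (hN : ∀ n ≥ N, dyadicDvd n a = 0) (b : ℤ_[2]) :
    HasSum (fun n : ℕ => -(2 * 4 ^ n * dyadicDvd (n + 1) a * scaleProfile n b))
      (∑ n ∈ Finset.range N, -(2 * 4 ^ n * dyadicDvd (n + 1) a * scaleProfile n b)) :=
  hasSum_sum_of_ne_finset_zero fun n hn => by
    rw [hN (n + 1) (by have := Finset.mem_range.not.1 hn; omega)]; ring

theorem measurable_odometerHoriz : Measurable odometerHoriz :=
  LatticeField.measurable_tsum_of_summable (fun n => by fun_prop) fun q =>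
    let ⟨_, hN⟩ := exists_dyadicDvd_eq_zero q.2
    (hasSum_odometerHoriz hN q.1).summable

theorem measurable_odometerVert : Measurable odometerVert :=
  LatticeField.measurable_tsum_of_summable (fun n => by fun_prop) fun q =>
    let ⟨_, hN⟩ := exists_dyadicDvd_eq_zero q.1
    (hasSum_odometerVert hN q.2).summable

/-- The divergence telescopes over the scales: the transport at scale `n` turns mass `4 ^ n` at
the points with both coordinates multiples of `2 ^ n` into mass `4 ^ (n + 1)` at those with both
coordinates multiples of `2 ^ (n + 1)`. -/
theorem odometer_divergence {a b : ℤ_[2]} (ha : a ≠ 0) (hb : b ≠ 0) :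
    odometerHoriz (a, b) - odometerHoriz (a - 1, b) +
      (odometerVert (a, b) - odometerVert (a, b - 1)) = 1 := by
  obtain ⟨M, hM⟩ := exists_dyadicDvd_eq_zero a
  obtain ⟨K, hK⟩ := exists_dyadicDvd_eq_zero b
  have hM' : ∀ n ≥ max M K, dyadicDvd n a = 0 := fun n hn => hM n ((le_max_left _ _).trans hn)
  have hK' : ∀ n ≥ max M K, dyadicDvd n b = 0 := fun n hn => hK n ((le_max_right _ _).trans hn)
  have h1 : ∀ x, odometerHoriz (x, b) = _ := fun x => (hasSum_odometerHoriz hK' x).tsum_eq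
  have h2 : ∀ x, odometerVert (a, x) = _ := fun x => (hasSum_odometerVert hM' x).tsum_eq
  rw [h1, h1, h2, h2, ← Finset.sum_sub_distrib, ← Finset.sum_sub_distrib, ← Finset.sum_add_distrib]
  have htel := Finset.sum_range_sub' (fun n => 4 ^ n * dyadicDvd n a * dyadicDvd n b) (max M K)
  rw [hM' _ le_rfl, dyadicDvd_zero_left ha, dyadicDvd_zero_left hb] at htel
  simp only [pow_zero, mul_one, mul_zero, zero_mul, sub_zero] at htel
  rw [← htel]
  refine Finset.sum_congr rfl fun n _ => ?_
  have ha' := scaleProfile_sub_scaleProfile n ha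
  have hb' := scaleProfile_sub_scaleProfile n hb
  linear_combination -(4 ^ n * dyadicDvd n b) * ha' - 2 * 4 ^ n * dyadicDvd (n + 1) a * hb'

/-- The translation of the dyadic plane by a lattice vector. -/
def odometerShift (z : ℤ × ℤ) (q : ℤ_[2] × ℤ_[2]) : ℤ_[2] × ℤ_[2] := (q.1 + z.1, q.2 + z.2)

theorem odometerShift_odometerShift (x y : ℤ × ℤ) (q : ℤ_[2] × ℤ_[2]) :
    odometerShift x (odometerShift y q) = odometerShift (x + y) q := by
  ext <;> simp [odometerShift] <;> ring

theorem measurePreserving_odometerShift (z : ℤ × ℤ) :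
    MeasurePreserving (odometerShift z) (dyadicMeasure.prod dyadicMeasure)
      (dyadicMeasure.prod dyadicMeasure) :=
  (measurePreserving_add_right dyadicMeasure (z.1 : ℤ_[2])).prod
    (measurePreserving_add_right dyadicMeasure (z.2 : ℤ_[2]))

/-- The lattice field seen from a vertex with dyadic coordinates `q`. -/
def odometerField (q : ℤ_[2] × ℤ_[2]) : LatticeField :=
  LatticeField.ofEdges (fun z => odometerHoriz (odometerShift z q))
    fun z => odometerVert (odometerShift z q)

theorem measurable_odometerField : Measurable odometerField :=
  LatticeField.measurable_ofEdges
    (fun z => measurable_odometerHoriz.comp (measurePreserving_odometerShift z).measurable)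
    fun z => measurable_odometerVert.comp (measurePreserving_odometerShift z).measurable

theorem shift_odometerField (z : ℤ × ℤ) (q : ℤ_[2] × ℤ_[2]) :
    (odometerField q).shift z = odometerField (odometerShift z q) := by
  simp only [odometerField, LatticeField.shift_ofEdges, odometerShift_odometerShift]

theorem ae_div_odometerField :
    ∀ᵐ q ∂dyadicMeasure.prod dyadicMeasure, ∀ x, (odometerField q).div x = 1 := by
  filter_upwards [Measure.quasiMeasurePreserving_fst.ae ae_add_intCast_ne_zero,
    Measure.quasiMeasurePreserving_snd.ae ae_add_intCast_ne_zero] with q h1 h2 x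
  rw [LatticeField.div_eq]
  simp only [odometerField, LatticeField.horiz_ofEdges, LatticeField.vert_ofEdges, odometerShift,
    Prod.fst_sub, Prod.snd_sub, Int.cast_sub, Int.cast_one, sub_zero, add_sub]
  rw [← odometer_divergence (h1 x.1) (h2 x.2)]
  ring

/-! ### Stationarity from measure-preserving maps of the sample space -/

section Stationary

variable {Ω : Type*} [MeasurableSpace Ω] {P : Measure Ω} {S : Set (ℝ × ℝ)}
  {F : Ω → ℝ × ℝ → ℝ × ℝ}

/-- If every shift of the field by a vector of `S` is realised by a measure-preserving map of the
sample space, then the law of the field is invariant under `S`. -/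
theorem isStationaryUnder_of_measurePreserving
    (hF : Measurable fun q : Ω × (ℝ × ℝ) => F q.1 q.2)
    (hS : ∀ a ∈ S, ∃ θ : Ω → Ω, MeasurePreserving θ P P ∧ ∀ s x, F s (x + a) = F (θ s) x) :
    IsStationaryUnder P S F := by
  refine ⟨hF, fun a ha => ?_⟩
  obtain ⟨θ, hθ, hFθ⟩ := hS a ha
  have hm : Measurable F := measurable_pi_iff.2 fun x => hF.comp
    (measurable_id.prodMk measurable_const)
  simp_rw [hFθ]
  conv_rhs => rw [← hθ.map_eq, Measure.map_map hm hθ.measurable]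
  rfl

theorem mollify_add (ρ : ℝ × ℝ → ℝ) (G : ℝ × ℝ → ℝ × ℝ) (x a : ℝ × ℝ) :
    mollify ρ G (x + a) = mollify ρ (fun y => G (y + a)) x := by
  simp only [mollify, convolution, add_sub_right_comm]

theorem measurable_mollify {ρ : ℝ × ℝ → ℝ} (hρ : Measurable ρ)
    (hF : Measurable fun q : Ω × (ℝ × ℝ) => F q.1 q.2) :
    Measurable fun q : Ω × (ℝ × ℝ) => mollify ρ (F q.1) q.2 := by
  have hm : Measurable fun r : (Ω × (ℝ × ℝ)) × (ℝ × ℝ) => ρ r.2 • F r.1.1 (r.1.2 - r.2) :=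
    (hρ.comp measurable_snd).smul (hF.comp (by fun_prop :
      Measurable fun r : (Ω × (ℝ × ℝ)) × (ℝ × ℝ) => (r.1.1, r.1.2 - r.2)))
  exact hm.stronglyMeasurable.integral_prod_right'.measurable

/-- Mollification is not measurable for the product `σ`-algebra, so the invariance of the law of
`ρ * F` does not follow from that of `F`; it follows from the maps of the sample space. -/
theorem isStationaryUnder_mollify {ρ : ℝ × ℝ → ℝ} (hρ : Measurable ρ)
    (hF : Measurable fun q : Ω × (ℝ × ℝ) => F q.1 q.2)
    (hS : ∀ a ∈ S, ∃ θ : Ω → Ω, MeasurePreserving θ P P ∧ ∀ s x, F s (x + a) = F (θ s) x) :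
    IsStationaryUnder P S fun s => mollify ρ (F s) := by
  refine isStationaryUnder_of_measurePreserving (measurable_mollify hρ hF) fun a ha => ?_
  obtain ⟨θ, hθ, hFθ⟩ := hS a ha
  exact ⟨θ, hθ, fun s x => by simp only [mollify_add, hFθ]⟩

end Stationary

/-! ### The sample space of the field and of the random shift -/

/-- Lebesgue measure on `[0, 1)²`. -/
def uniformMeasure : Measure (ℝ × ℝ) := volume.restrict (Ico (0 : ℝ) 1 ×ˢ Ico (0 : ℝ) 1)

theorem uniformMeasure_eq_prod : uniformMeasure =
    (volume.restrict (Ico (0 : ℝ) 1)).prod (volume.restrict (Ico (0 : ℝ) 1)) := by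
  rw [uniformMeasure, Measure.volume_eq_prod, Measure.prod_restrict]

instance : IsProbabilityMeasure uniformMeasure :=
  ⟨by simp [uniformMeasure, Measure.volume_eq_prod]⟩

/-- The law of the pair of a uniform shift and an independent Haar point of the dyadic plane. -/
def sampleMeasure : Measure ((ℝ × ℝ) × (ℤ_[2] × ℤ_[2])) :=
  uniformMeasure.prod (dyadicMeasure.prod dyadicMeasure)

instance : IsProbabilityMeasure sampleMeasure :=
  inferInstanceAs (IsProbabilityMeasure (uniformMeasure.prod _))

/-- The integer part of a point of the plane. -/
def planeFloor (x : ℝ × ℝ) : ℤ × ℤ := (⌊x.1⌋, ⌊x.2⌋)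

/-- The fractional part of a point of the plane. -/
def planeFract (x : ℝ × ℝ) : ℝ × ℝ := (Int.fract x.1, Int.fract x.2)

theorem planeFract_add_latticePoint_planeFloor (x : ℝ × ℝ) :
    planeFract x + latticePoint (planeFloor x) = x := by
  ext <;> simp [planeFract, planeFloor, latticePoint]

/-- The motion of the sample space induced by a translation of the plane by `a`: the shift moves
inside the unit square and the integer part of the motion acts on the lattice. -/
def planeShift (a : ℝ × ℝ) (s : (ℝ × ℝ) × (ℤ_[2] × ℤ_[2])) : (ℝ × ℝ) × (ℤ_[2] × ℤ_[2]) :=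
  (planeFract (a + s.1), odometerShift (planeFloor (a + s.1)) s.2)

theorem measurePreserving_planeFract_add (a : ℝ × ℝ) :
    MeasurePreserving (fun u => planeFract (a + u)) uniformMeasure uniformMeasure := by
  rw [uniformMeasure_eq_prod]
  exact (measurePreserving_fract_const_add a.1).prod (measurePreserving_fract_const_add a.2)

theorem measurePreserving_planeShift (a : ℝ × ℝ) :
    MeasurePreserving (planeShift a) sampleMeasure sampleMeasure := by
  refine (measurePreserving_planeFract_add a).skew_product
    (g := fun u => odometerShift (planeFloor (a + u))) ?_
    (.of_forall fun u => (measurePreserving_odometerShift _).map_eq)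
  have h : Measurable fun x : ℝ × ℝ => planeFloor x :=
    (Int.measurable_floor.comp measurable_fst).prodMk (Int.measurable_floor.comp measurable_snd)
  -- the lattice is countable, so measurability can be checked for each integer part
  have h2 : Measurable fun q : (ℤ_[2] × ℤ_[2]) × (ℤ × ℤ) => odometerShift q.2 q.1 :=
    measurable_from_prod_countable_left fun z => (measurePreserving_odometerShift z).measurable
  exact h2.comp (measurable_snd.prodMk (h.comp (measurable_fst.const_add a)))

theorem measurePreserving_latticeShift (z : ℤ × ℤ) :
    MeasurePreserving (Prod.map id (odometerShift z)) sampleMeasure sampleMeasure :=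
  (MeasurePreserving.id _).prod (measurePreserving_odometerShift z)

theorem smoothed_odometerShift (z : ℤ × ℤ) (q : ℤ_[2] × ℤ_[2]) (p : ℝ × ℝ) :
    (odometerField (odometerShift z q)).smoothed p =
      (odometerField q).smoothed (p + latticePoint z) := by
  rw [← shift_odometerField, LatticeField.smoothed_shift]

theorem smoothed_planeShift (a : ℝ × ℝ) (s : (ℝ × ℝ) × (ℤ_[2] × ℤ_[2])) (x : ℝ × ℝ) :
    (odometerField (planeShift a s).2).smoothed (x + (planeShift a s).1) =
      (odometerField s.2).smoothed (x + a + s.1) := by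
  rw [planeShift, smoothed_odometerShift, add_assoc, planeFract_add_latticePoint_planeFloor,
    add_assoc]

end

theorem mainTheorem3 :
    (∀ w : LatticeField, (∀ x, w.div x = 1) →
      (∀ᵐ p : ℝ × ℝ, HasDivergenceAt w.smoothed 1 p) ∧
      HasDistribDivergence w.smoothed 1 ∧
      ∀ ρ : ℝ × ℝ → ℝ, IsMollifier ρ →
        ContDiff ℝ ∞ (mollify ρ w.smoothed) ∧
        ∀ p, HasDivergenceAt (mollify ρ w.smoothed) 1 p) ∧
    ∃ (Ω : Type) (_ : MeasurableSpace Ω) (P : Measure Ω) (_ : IsProbabilityMeasure P)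
      (v : Ω → LatticeField) (U : Ω → ℝ × ℝ) (F : Ω → ℝ × ℝ → ℝ × ℝ),
      IsStationaryLattice P v ∧
      (∀ᵐ s ∂P, ∀ x, (v s).div x = 1) ∧
      IsStationaryUnder P integerPoints (fun s => (v s).smoothed) ∧
      Measurable U ∧
      P.map U = volume.restrict (Ico (0 : ℝ) 1 ×ˢ Ico (0 : ℝ) 1) ∧
      IndepFun v U P ∧
      (∀ s p, F s p = (v s).smoothed (p + U s)) ∧
      IsStationaryUnder P univ F ∧
      (∀ᵐ s ∂P, (∀ᵐ p : ℝ × ℝ, HasDivergenceAt (F s) 1 p) ∧ HasDistribDivergence (F s) 1) ∧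
      ∀ ρ : ℝ × ℝ → ℝ, IsMollifier ρ →
        IsStationaryUnder P integerPoints (fun s => mollify ρ (v s).smoothed) ∧
        IsStationaryUnder P univ (fun s => mollify ρ (F s)) ∧
        ∀ᵐ s ∂P, ContDiff ℝ ∞ (mollify ρ (F s)) ∧
          ∀ p, HasDivergenceAt (mollify ρ (F s)) 1 p := by
  refine ⟨fun w hw => ⟨LatticeField.ae_hasDivergenceAt_smoothed hw,
    LatticeField.hasDistribDivergence_smoothed hw, fun ρ hρ =>
      (LatticeField.hasDistribDivergence_smoothed hw).mollify hρ⟩, ?_⟩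
  have hv : Measurable fun s : (ℝ × ℝ) × (ℤ_[2] × ℤ_[2]) => odometerField s.2 :=
    measurable_odometerField.comp measurable_snd
  have hdiv : ∀ᵐ s ∂sampleMeasure, ∀ x, (odometerField s.2).div x = 1 :=
    Measure.quasiMeasurePreserving_snd.ae ae_div_odometerField
  have hmv : Measurable fun q : ((ℝ × ℝ) × (ℤ_[2] × ℤ_[2])) × (ℝ × ℝ) =>
      (odometerField q.1.2).smoothed q.2 :=
    LatticeField.measurable_smoothed.comp ((hv.comp measurable_fst).prodMk measurable_snd)
  have hmF : Measurable fun q : ((ℝ × ℝ) × (ℤ_[2] × ℤ_[2])) × (ℝ × ℝ) =>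
      (odometerField q.1.2).smoothed (q.2 + q.1.1) :=
    LatticeField.measurable_smoothed.comp ((hv.comp measurable_fst).prodMk (by fun_prop))
  have hSv : ∀ a ∈ integerPoints, ∃ θ, MeasurePreserving θ sampleMeasure sampleMeasure ∧
      ∀ s x, (odometerField s.2).smoothed (x + a) = (odometerField (θ s).2).smoothed x := by
    rintro _ ⟨z, rfl⟩
    exact ⟨_, measurePreserving_latticeShift z, fun s x => (smoothed_odometerShift z s.2 x).symm⟩
  have hSF : ∀ a ∈ (univ : Set (ℝ × ℝ)),
      ∃ θ, MeasurePreserving θ sampleMeasure sampleMeasure ∧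
      ∀ s x, (odometerField s.2).smoothed (x + a + s.1) =
        (odometerField (θ s).2).smoothed (x + (θ s).1) :=
    fun a _ => ⟨_, measurePreserving_planeShift a, fun s x => (smoothed_planeShift a s x).symm⟩
  have hdist : ∀ᵐ s ∂sampleMeasure,
      HasDistribDivergence (fun p => (odometerField s.2).smoothed (p + s.1)) 1 := by
    filter_upwards [hdiv] with s hs
    exact (LatticeField.hasDistribDivergence_smoothed hs).comp_add_right s.1
  refine ⟨(ℝ × ℝ) × (ℤ_[2] × ℤ_[2]), inferInstance, sampleMeasure, inferInstance,
    fun s => odometerField s.2, fun s => s.1, fun s p => (odometerField s.2).smoothed (p + s.1),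
    ⟨hv, fun z => ?_⟩, hdiv, isStationaryUnder_of_measurePreserving hmv hSv, measurable_fst,
    measurePreserving_fst.map_eq, ?_, fun _ _ => rfl,
    isStationaryUnder_of_measurePreserving hmF hSF, ?_, fun ρ hρ => ⟨?_, ?_, ?_⟩⟩
  · simp_rw [shift_odometerField]
    conv_rhs => rw [← (measurePreserving_latticeShift z).map_eq,
      Measure.map_map hv (measurePreserving_latticeShift z).measurable]
    rfl
  · exact (indepFun_prod measurable_id measurable_odometerField).symm
  · filter_upwards [hdiv, hdist] with s hs hs'
    refine ⟨?_, hs'⟩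
    filter_upwards [(measurePreserving_add_right volume s.1).quasiMeasurePreserving.ae
      (LatticeField.ae_hasDivergenceAt_smoothed hs)] with p hp
    exact hp.comp_add_right
  · exact isStationaryUnder_mollify hρ.1.continuous.measurable hmv hSv
  · exact isStationaryUnder_mollify hρ.1.continuous.measurable hmF hSF
  · filter_upwards [hdist] with s hs
    exact hs.mollify hρ
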